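/- Let $m,n\in\mathbb N$, $\varepsilon>0$, $p\in[2,\infty)$ and $A\in\mathbb R^{m\times n}$. Define the following notions. - For $R\in\mathbb R^{k\times n}$, $\|R\|_{1\to2}=\max_{\|x\|_1\le 1}\|Rx\|_2$; for $U\in\mathbb R^{m\times m}$ positive semidefinite and $q<\infty$, $\mathrm{tr}_q(U)=\bigl(\sum_{i=1}^m U_{ii}^q\bigr)^{1/q}$; and $$\gamma_{(p)}(A)=\min\Bigl\{\sqrt{\mathrm{tr}_{p/2}(LL^\top)}\;\|R\|_{1\to 2}\;:\;k\in\mathbb N,\ L\in\mathbb R^{m\times k},\ R\in\mathbb R^{k\times n},\ LR=A\Bigr\}.$$ - $\displaystyle \kappa(A)=\min_{\|\theta\|_2=1}\Bigl(\max_{\|x\|_1\le1}\theta^\top Ax-\min_{\|x\|_1\le1}\theta^\top Ax\Bigr)$. - A randomized mechanism $\mathcal M:\mathbb R^n\to\mathbb R^m$ is $(\varepsilon,\delta)$-differentially private if $\Pr[\mathcal M(x)\in S]\le e^{\varepsilon}\Pr[\mathcal M(x')\in S]+\delta$ for every measurable $S\subseteq\mathbb R^m$ and all $x,x'\in\mathbb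 R^n$ with $\|x-x'\|_1\le 1$. It is an additive noise mechanism for $A$ if $\mathcal M(x)=Ax+z$ for all $x$, where $z$ is a random vector in $\mathbb R^m$ whose distribution does not depend on $x$; $z$ need not have mean zero. **Theorem (lower bound for additive noise mechanisms).** Let $$0\le\delta\le\min\Bigl\{\tfrac1{16},\ \varepsilon^2,\ \frac{\varepsilon\,\kappa(A)\,n^{1-2/p}}{12\,\gamma_{(p)}(A)}\Bigr\}$$ (the last term is left out if $\gamma_{(p)}(A)=0$), and let $\mathcal M$ be an $(\varepsilon,\delta)$-differentially private additive noise mechanism for $A$. Then for every $x\in\mathbb R^n$, $$\Bigl(\mathbb E\bigl[\|\mathcal M(x)-Ax\|_p^p\bigr]\Bigr)^{1/p}\ \ge\ \frac{(1-\delta')\,\gamma_{(p)}(A)}{8\,(e^{3\varepsilon}-1)},\qquad \delta'=\frac{2\delta}{1-e^{-\varepsilon}},$$ where the left-hand side is $+\infty$ if the expectation is infinite. -/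

import Mathlib

open MeasureTheory
open scoped ENNReal Matrix

namespace DPLinearQueries

noncomputable section

/-- Two datasets `x, y ∈ ℝⁿ` are neighboring if `‖x - y‖₁ ≤ 1`. -/
def Neighboring {n : ℕ} (x y : Fin n → ℝ) : Prop :=
  ‖WithLp.toLp 1 (x - y)‖ ≤ 1

/-- A randomized mechanism `ℝⁿ → ℝᵐ`: each dataset is sent to the law of the random output. -/
abbrev Mechanism (n m : ℕ) : Type :=
  (Fin n → ℝ) → ProbabilityMeasure (Fin m → ℝ)

/-- `(ε, δ)`-differential privacy:
`Pr[M(x) ∈ S] ≤ e^ε Pr[M(y) ∈ S] + δ` for all neighboring `x, y` and all measurable `S`. -/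
def IsDP {n m : ℕ} (ε δ : ℝ) (M : Mechanism n m) : Prop :=
  ∀ x y : Fin n → ℝ, Neighboring x y → ∀ S : Set (Fin m → ℝ), MeasurableSet S →
    (M x : Measure (Fin m → ℝ)).real S ≤
      Real.exp ε * (M y : Measure (Fin m → ℝ)).real S + δ

/-- `M` is an additive noise mechanism for the query matrix `A`: `M(x) = A x + z`, where the law
`ν` of the noise `z` does not depend on `x` (and is otherwise arbitrary, possibly biased). -/
def IsAdditiveNoise {n m : ℕ} (A : Matrix (Fin m) (Fin n) ℝ) (M : Mechanism n m) : Prop :=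
  ∃ ν : ProbabilityMeasure (Fin m → ℝ), ∀ x : Fin n → ℝ,
    (M x : Measure (Fin m → ℝ)) = (ν : Measure (Fin m → ℝ)).map (fun z => A *ᵥ x + z)

/-- The error `(𝔼 ‖M(x) - A x‖_p ^ p) ^ (1 / p) ∈ [0, ∞]` at the dataset `x`. -/
def lpError {n m : ℕ} (p : ℝ) (A : Matrix (Fin m) (Fin n) ℝ) (M : Mechanism n m)
    (x : Fin n → ℝ) : ℝ≥0∞ :=
  (∫⁻ y, ENNReal.ofReal (‖WithLp.toLp (ENNReal.ofReal p) (y - A *ᵥ x)‖ ^ p)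
    ∂(M x : Measure (Fin m → ℝ))) ^ (1 / p)

/-- The `p`-trace `tr_p(U) = (∑ i, U_ii ^ p) ^ (1 / p)` for finite `p`. -/
def pTrace {d : ℕ} (p : ℝ) (U : Matrix (Fin d) (Fin d) ℝ) : ℝ :=
  (∑ i, U i i ^ p) ^ (1 / p)

/-- The operator norm `‖R‖_{1 → 2} = max_{‖x‖₁ = 1} ‖R x‖₂`. -/
def norm12 {k n : ℕ} (R : Matrix (Fin k) (Fin n) ℝ) : ℝ :=
  ‖LinearMap.toContinuousLinearMap (Matrix.toLpLin 1 2 R)‖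

/-- The factorization norm `γ_(p)(A)`: the infimum of `√(tr_{p/2}(L Lᵀ)) ‖R‖_{1 → 2}` over all
factorizations `L R = A`, of arbitrary inner dimension `k`. -/
def gammaNorm {m n : ℕ} (p : ℝ) (A : Matrix (Fin m) (Fin n) ℝ) : ℝ :=
  sInf {c : ℝ | ∃ (k : ℕ) (L : Matrix (Fin m) (Fin k) ℝ) (R : Matrix (Fin k) (Fin n) ℝ),
    L * R = A ∧ c = √(pTrace (p / 2) (L * Lᵀ)) * norm12 R}

/-- The sensitivity polytope `A B₁ⁿ = {A x : ‖x‖₁ ≤ 1}`. -/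
def sensitivityPolytope {m n : ℕ} (A : Matrix (Fin m) (Fin n) ℝ) : Set (Fin m → ℝ) :=
  (fun x => A *ᵥ x) '' {x : Fin n → ℝ | ‖WithLp.toLp 1 x‖ ≤ 1}

/-- The width `w_K(θ) = max_{v ∈ K} θᵀ v - min_{v ∈ K} θᵀ v`. -/
def width {m : ℕ} (K : Set (Fin m → ℝ)) (θ : Fin m → ℝ) : ℝ :=
  sSup ((fun v => θ ⬝ᵥ v) '' K) - sInf ((fun v => θ ⬝ᵥ v) '' K)

/-- `κ(A) = min_{‖θ‖₂ = 1} w_{A B₁ⁿ}(θ)`. -/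
def kappa {m n : ℕ} (A : Matrix (Fin m) (Fin n) ℝ) : ℝ :=
  sInf (width (sensitivityPolytope A) '' {θ : Fin m → ℝ | ‖WithLp.toLp 2 θ‖ = 1})

/-- `δ(A, ε, n) = min {1/16, ε², ε κ(A) n^(1 - 2/p) / (12 γ_(p)(A))}`; if `γ_(p)(A) = 0` the
last term is undefined and is left out. -/
def deltaThreshold {m n : ℕ} (p ε : ℝ) (A : Matrix (Fin m) (Fin n) ℝ) : ℝ :=
  if gammaNorm p A = 0 then min (1 / 16) (ε ^ 2)
  else min (min (1 / 16) (ε ^ 2))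
    (ε * kappa A * (n : ℝ) ^ (1 - 2 / p) / (12 * gammaNorm p A))

end

end DPLinearQueries

namespace DPLinearQueries

/-! Let `U = 𝔼 z zᵀ` be the raw second moment matrix of the noise, so bias plays no role. If `a` is
a column of `A`, the slab `|θᵀz| < k|θᵀa|/2` is disjoint from its translate by `k a`, so group
privacy forbids the noise to concentrate on it. By Chebyshev, with `k ≈ 1/(2ε)`, this gives `(θᵀa)²
≤ C² θᵀUθ` for every `θ`, where `C = 8(e^{3ε} - 1)/(1 - δ')`.

Write `U = L Lᵀ`. By convex duality each column of `A` is `L r` with `‖r‖₂ ≤ C`, so `U` yields a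
factorization of cost at most `C √(tr_{p/2} U)`. Jensen bounds `√(tr_{p/2} U)` by the `ℓ_p` error.
-/

/-! ### Privacy forces spread in every direction -/

/-- Group privacy along a fixed direction of `ℓ₁` norm at most one. -/
theorem IsDP.group_privacy {n m : ℕ} {ε δ : ℝ} {M : Mechanism n m} (hDP : IsDP ε δ M)
    {v : Fin n → ℝ} (hv : ‖WithLp.toLp 1 v‖ ≤ 1) {S : Set (Fin m → ℝ)} (hS : MeasurableSet S)
    (k : ℕ) :
    (M 0 : Measure (Fin m → ℝ)).real S ≤
      Real.exp ε ^ k * (M ((k : ℝ) • v) : Measure (Fin m → ℝ)).real S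
        + δ * ∑ i ∈ Finset.range k, Real.exp ε ^ i := by
  induction k with
  | zero => simp
  | succ k ih =>
    have hn : Neighboring ((k : ℝ) • v) (((k + 1 : ℕ) : ℝ) • v) := by
      unfold Neighboring
      rw [← sub_smul, WithLp.toLp_smul, norm_smul]
      simpa using hv
    have h := mul_le_mul_of_nonneg_left (hDP _ _ hn S hS) (pow_nonneg (Real.exp_pos ε).le k)
    rw [Finset.sum_range_succ, pow_succ]
    linarith

/-- The noise of a private additive mechanism is spread out in every direction: a shift by `k`
steps bounds the second moment of the marginal from below. -/
theorem second_moment_of_shift {m n : ℕ} {ε δ : ℝ} {A : Matrix (Fin m) (Fin n) ℝ}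
    {M : Mechanism n m} (hDP : IsDP ε δ M) {ν : ProbabilityMeasure (Fin m → ℝ)}
    (hν : ∀ x : Fin n → ℝ, (M x : Measure (Fin m → ℝ)) =
      (ν : Measure (Fin m → ℝ)).map (fun z => A *ᵥ x + z))
    {v : Fin n → ℝ} (hv : ‖WithLp.toLp 1 v‖ ≤ 1) (θ : Fin m → ℝ)
    (hint : Integrable (fun z => (θ ⬝ᵥ z) ^ 2) (ν : Measure (Fin m → ℝ))) (k : ℕ) :
    (1 - δ * ∑ i ∈ Finset.range k, Real.exp ε ^ i) * ((k * (θ ⬝ᵥ A *ᵥ v)) / 2) ^ 2 ≤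
      (1 + Real.exp ε ^ k) * ∫ z, (θ ⬝ᵥ z) ^ 2 ∂(ν : Measure (Fin m → ℝ)) := by
  set T : ℝ := ((k * (θ ⬝ᵥ A *ᵥ v)) / 2) ^ 2 with hT
  set ρ : Measure (Fin m → ℝ) := (ν : Measure (Fin m → ℝ))
  have hmeas : Measurable (fun z : Fin m → ℝ => (θ ⬝ᵥ z) ^ 2) := by
    unfold dotProduct; fun_prop
  set S : Set (Fin m → ℝ) := {z | (θ ⬝ᵥ z) ^ 2 < T} with hSdef
  have hS : MeasurableSet S := measurableSet_lt hmeas measurable_const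
  have hcompl : Sᶜ = {z | T ≤ (θ ⬝ᵥ z) ^ 2} := by ext z; simp [hSdef]
  have h0 : (M 0 : Measure (Fin m → ℝ)).real S = ρ.real S := by
    rw [hν 0]; simp [ρ]
  -- Two points of the slab differ along `θ` by less than `k|θᵀAv|`, so the slab misses its
  -- translate.
  have hk : (M ((k : ℝ) • v) : Measure (Fin m → ℝ)).real S ≤ ρ.real Sᶜ := by
    rw [hν, map_measureReal_apply (by fun_prop) hS]
    refine measureReal_mono fun z hz => ?_
    rw [hcompl]
    simp only [hSdef, Set.mem_preimage, Set.mem_ofPred_eq, dotProduct_add, Matrix.mulVec_smul,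
      dotProduct_smul, smul_eq_mul] at hz ⊢
    rw [hT] at hz ⊢
    by_contra! hlt
    have h2 := sq_lt_sq.mp hlt
    have h1' := sq_lt_sq.mp hz
    have h3 := abs_sub (k * (θ ⬝ᵥ A *ᵥ v) + θ ⬝ᵥ z) (θ ⬝ᵥ z)
    rw [add_sub_cancel_right] at h3
    rw [abs_div, abs_two] at h2 h1'
    linarith
  have hq : ρ.real S = 1 - ρ.real Sᶜ := by rw [probReal_compl_eq_one_sub hS]; ring
  have hgp := hDP.group_privacy hv hS k
  have hcheb : T * ρ.real Sᶜ ≤ ∫ z, (θ ⬝ᵥ z) ^ 2 ∂ρ := by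
    rw [hcompl]
    exact mul_meas_ge_le_integral_of_nonneg (ae_of_all _ fun z => sq_nonneg _) hint T
  have hE : 0 < Real.exp ε ^ k := pow_pos (Real.exp_pos ε) k
  rw [h0, hq] at hgp
  have h1 : 1 - δ * ∑ i ∈ Finset.range k, Real.exp ε ^ i ≤ (1 + Real.exp ε ^ k) * ρ.real Sᶜ := by
    nlinarith [mul_le_mul_of_nonneg_left hk hE.le]
  calc _ ≤ (1 + Real.exp ε ^ k) * ρ.real Sᶜ * T := mul_le_mul_of_nonneg_right h1 (sq_nonneg _)
    _ = (1 + Real.exp ε ^ k) * (T * ρ.real Sᶜ) := by ring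
    _ ≤ _ := mul_le_mul_of_nonneg_left hcheb (by positivity)

/-- Choosing about `1 / (2 ε)` shifts makes the bound of `second_moment_of_shift` explicit. -/
theorem exists_shift_count {ε δ : ℝ} (hε : 0 < ε) (hδ0 : 0 ≤ δ)
    (hδ' : 2 * δ / (1 - Real.exp (-ε)) < 1) {t s : ℝ} (hs : 0 ≤ s)
    (h : ∀ k : ℕ, (1 - δ * ∑ i ∈ Finset.range k, Real.exp ε ^ i) * ((k * t) / 2) ^ 2 ≤
      (1 + Real.exp ε ^ k) * s) :
    t ^ 2 ≤ (8 * (Real.exp (3 * ε) - 1) / (1 - 2 * δ / (1 - Real.exp (-ε)))) ^ 2 * s := by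
  set d := 2 * δ / (1 - Real.exp (-ε)) with hd
  -- Then `1/2 ≤ kε ≤ 1/2 + ε`: the shift is long, yet `e^{kε} ≤ 2e^ε`.
  set k := ⌈1 / (2 * ε)⌉₊ with hkdef
  set e := Real.exp ε with he
  have he1 : 1 + ε ≤ e := by linarith [Real.add_one_le_exp ε]
  have hk1 : 1 / (2 * ε) ≤ k := Nat.le_ceil _
  have hk2 : (k : ℝ) < 1 / (2 * ε) + 1 := Nat.ceil_lt_add_one (by positivity)
  have hkε : 1 ≤ 2 * (k * ε) := by
    rw [div_le_iff₀ (by positivity)] at hk1; linarith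
  have hkε' : k * ε ≤ 1 / 2 + ε := by
    have := mul_le_mul_of_nonneg_right hk2.le hε.le
    have h2 : (1 / (2 * ε) + 1) * ε = 1 / 2 + ε := by field_simp
    linarith
  have hhalf : Real.exp (1 / 2) ≤ 2 := by
    have h1 := Real.exp_one_lt_d9
    have h2 : Real.exp (1 / 2) * Real.exp (1 / 2) = Real.exp 1 := by
      rw [← Real.exp_add]; norm_num
    nlinarith [Real.exp_pos (1 / 2 : ℝ)]
  have hpow : e ^ k ≤ 2 * e := by
    rw [he, ← Real.exp_nat_mul]
    calc Real.exp (k * ε) ≤ Real.exp (1 / 2 + ε) := Real.exp_le_exp.mpr hkε'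
      _ = Real.exp (1 / 2) * Real.exp ε := Real.exp_add _ _
      _ ≤ _ := mul_le_mul_of_nonneg_right hhalf (Real.exp_pos _).le
  have hd0 : 0 ≤ d := by
    have : Real.exp (-ε) ≤ 1 := Real.exp_le_one_iff.mpr (by linarith)
    exact div_nonneg (by linarith) (by linarith)
  -- The geometric sum is at most `2e/(e - 1)`; this is the source of the 2 in `δ'`.
  have hsum : δ * ∑ i ∈ Finset.range k, e ^ i ≤ d := by
    have hd2 : d = δ * (2 * e / (e - 1)) := by
      rw [hd, Real.exp_neg, ← he]
      have : e - 1 ≠ 0 := by linarith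
      have : e ≠ 0 := by linarith
      field_simp
    rw [hd2, geom_sum_eq (by linarith)]
    gcongr
    · linarith
    · linarith
  have hkey := h k
  have hfin : (1 - d) * ((k * t) / 2) ^ 2 ≤ (1 + 2 * e) * s := by
    calc _ ≤ (1 - δ * ∑ i ∈ Finset.range k, e ^ i) * ((k * t) / 2) ^ 2 := by gcongr
      _ ≤ _ := hkey
      _ ≤ _ := by gcongr
  -- Factor `e³ - 1 = (e - 1)(e² + e + 1)` and use `e - 1 ≥ ε`.
  have h3 : 2 * e * ε ≤ Real.exp (3 * ε) - 1 := by
    have h31 : Real.exp (3 * ε) = e ^ 3 := by rw [he, ← Real.exp_nat_mul]; norm_num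
    rw [h31]
    nlinarith [mul_nonneg hε.le hε.le, sq_nonneg (e - 1)]
  set F := Real.exp (3 * ε) - 1
  have hF : 0 < F := lt_of_lt_of_le (by positivity) h3
  have hkF : e ≤ k * F := by
    calc e = e * 1 := by ring
      _ ≤ e * (2 * (k * ε)) := by gcongr
      _ = k * (2 * e * ε) := by ring
      _ ≤ _ := by gcongr
  have hd1 : 0 < 1 - d := by linarith
  have hk0 : (0 : ℝ) < k := lt_of_lt_of_le (by positivity) hk1
  have hmain : (1 - d) * t ^ 2 * k ^ 2 ≤ 64 * F ^ 2 * s * k ^ 2 := by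
    have : e ^ 2 ≤ (k * F) ^ 2 := by gcongr
    -- Since `1 ≤ e ≤ kF`, even `3(kF)²` suffices; 16 makes the final constant `4 · 16 = 8²`.
    have h5 : (1 + 2 * e) ≤ 16 * (k * F) ^ 2 := by nlinarith
    have := mul_le_mul_of_nonneg_right h5 hs
    nlinarith
  have hmain' : (1 - d) * t ^ 2 ≤ 64 * F ^ 2 * s := le_of_mul_le_mul_right hmain (by positivity)
  rw [div_pow, div_mul_eq_mul_div, le_div_iff₀ (by positivity)]
  have : (1 - d) ^ 2 * t ^ 2 ≤ (1 - d) * t ^ 2 := by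
    have : (1 - d) ^ 2 ≤ 1 - d := by nlinarith
    gcongr
  nlinarith

/-! ### From quadratic form domination to factorizations -/

/-- A vector dominated by `Lᵀ` in every direction is the image under `L` of a short vector. -/
theorem exists_mulVec_eq_of_dotProduct_sq_le {m k : ℕ} (L : Matrix (Fin m) (Fin k) ℝ)
    (a : Fin m → ℝ) {C : ℝ} (hC : 0 ≤ C)
    (h : ∀ θ : Fin m → ℝ, (θ ⬝ᵥ a) ^ 2 ≤ C ^ 2 * (θ ⬝ᵥ (L * Lᵀ) *ᵥ θ)) :
    ∃ r : EuclideanSpace ℝ (Fin k), L *ᵥ r.ofLp = a ∧ ‖r‖ ≤ C := by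
  by_contra! hne
  set g : EuclideanSpace ℝ (Fin k) →ₗ[ℝ] (Fin m → ℝ) :=
    L.mulVecLin ∘ₗ (WithLp.linearEquiv 2 ℝ (Fin k → ℝ)).toLinearMap with hg
  have hgr (r : EuclideanSpace ℝ (Fin k)) : g r = L *ᵥ r.ofLp := rfl
  have hcont : Continuous g := g.continuous_of_finiteDimensional
  have hcomp : IsCompact (g '' Metric.closedBall 0 C) :=
    (isCompact_closedBall 0 C).image hcont
  have hconv : Convex ℝ (g '' Metric.closedBall 0 C) := (convex_closedBall 0 C).linear_image g
  have hnot : a ∉ g '' Metric.closedBall 0 C := by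
    rintro ⟨r, hr, hra⟩
    exact absurd (hne r hra) (not_lt.mpr (mem_closedBall_zero_iff.mp hr))
  obtain ⟨f, u, hfu, hua⟩ := geometric_hahn_banach_closed_point hconv hcomp.isClosed hnot
  set θ : Fin m → ℝ := fun i => f (Pi.single i 1) with hθ
  have hf (y : Fin m → ℝ) : f y = θ ⬝ᵥ y := by
    conv_lhs => rw [← Finset.univ_sum_single y, map_sum]
    refine Finset.sum_congr rfl fun i _ => ?_
    have : (Pi.single i (y i) : Fin m → ℝ) = y i • Pi.single i 1 := by
      rw [← Pi.single_smul, smul_eq_mul, mul_one]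
    rw [this, map_smul, smul_eq_mul, mul_comm]
  set w : EuclideanSpace ℝ (Fin k) := WithLp.toLp 2 (Lᵀ *ᵥ θ) with hw
  have hw2 : θ ⬝ᵥ (L * Lᵀ) *ᵥ θ = ‖w‖ ^ 2 := by
    rw [← Matrix.mulVec_mulVec, Matrix.dotProduct_mulVec, ← Matrix.mulVec_transpose,
      EuclideanSpace.norm_sq_eq]
    simp [dotProduct, hw, sq]
  have ha := h θ
  rw [hw2, ← mul_pow] at ha
  have ha' : θ ⬝ᵥ a ≤ C * ‖w‖ := le_of_abs_le (abs_le_of_sq_le_sq ha (by positivity))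
  -- The support function of the image of the ball at `θ` is `C‖Lᵀθ‖`, attained at `(C/‖w‖) w`; if
  -- `w = 0`, the centre suffices.
  have hu : C * ‖w‖ ≤ u := by
    by_cases hw0 : ‖w‖ = 0
    · have := hfu (g 0) ⟨0, by simpa using hC, rfl⟩
      rw [map_zero, map_zero] at this
      rw [hw0, mul_zero]; exact this.le
    · have := hfu (g ((C / ‖w‖) • w)) ⟨_, by
        rw [mem_closedBall_zero_iff, norm_smul, Real.norm_of_nonneg (by positivity),
          div_mul_cancel₀ _ hw0], rfl⟩
      have h2 : θ ⬝ᵥ L *ᵥ w.ofLp = ‖w‖ ^ 2 := by rw [← hw2, ← Matrix.mulVec_mulVec]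
      rw [map_smul, map_smul, hf, hgr, h2, smul_eq_mul] at this
      have h3 : C / ‖w‖ * ‖w‖ ^ 2 = C * ‖w‖ := by field_simp
      linarith
  rw [hf] at hua
  linarith

/-- Triangle inequality over the columns, weighted by `|x j|`. -/
theorem norm12_le {k n : ℕ} (R : Matrix (Fin k) (Fin n) ℝ) {C : ℝ} (hC : 0 ≤ C)
    (h : ∀ j, ‖(WithLp.toLp 2 (R.col j) : EuclideanSpace ℝ (Fin k))‖ ≤ C) : norm12 R ≤ C := by
  refine ContinuousLinearMap.opNorm_le_bound _ hC fun x => ?_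
  have hx : LinearMap.toContinuousLinearMap (Matrix.toLpLin 1 2 R) x =
      ∑ j, x j • (WithLp.toLp 2 (R.col j) : EuclideanSpace ℝ (Fin k)) := by
    ext i
    simp [Matrix.mulVec, dotProduct, mul_comm]
  rw [hx, PiLp.norm_eq_of_L1, Finset.mul_sum]
  refine (norm_sum_le _ _).trans (Finset.sum_le_sum fun j _ => ?_)
  rw [norm_smul, mul_comm]
  exact mul_le_mul_of_nonneg_right (h j) (norm_nonneg _)

theorem gammaNorm_nonneg {m n : ℕ} (p : ℝ) (A : Matrix (Fin m) (Fin n) ℝ) :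
    0 ≤ gammaNorm p A := by
  refine Real.sInf_nonneg ?_
  rintro _ ⟨k, L, R, -, rfl⟩
  exact mul_nonneg (Real.sqrt_nonneg _) (norm_nonneg _)

/-- A positive semidefinite `U` dominating the columns of `A` bounds the factorization norm. -/
theorem gammaNorm_le_of_posSemidef {m n : ℕ} (p : ℝ) (A : Matrix (Fin m) (Fin n) ℝ)
    {U : Matrix (Fin m) (Fin m) ℝ} (hU : U.PosSemidef) {C : ℝ} (hC : 0 ≤ C)
    (h : ∀ (θ : Fin m → ℝ) (j : Fin n), (θ ⬝ᵥ A.col j) ^ 2 ≤ C ^ 2 * (θ ⬝ᵥ U *ᵥ θ)) :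
    gammaNorm p A ≤ √(pTrace (p / 2) U) * C := by
  open scoped MatrixOrder in
  obtain ⟨B, hB⟩ := CStarAlgebra.nonneg_iff_eq_star_mul_self.mp hU.nonneg
  have hUL : U = Bᵀ * Bᵀᵀ := by
    rw [hB, Matrix.star_eq_conjTranspose, Matrix.conjTranspose_eq_transpose_of_trivial,
      Matrix.transpose_transpose]
  rw [hUL] at h ⊢
  choose r hr hrC using fun j => exists_mulVec_eq_of_dotProduct_sq_le Bᵀ (A.col j) hC fun θ => h θ j
  set R : Matrix (Fin m) (Fin n) ℝ := Matrix.of fun i j => r j i with hR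
  have hLR : Bᵀ * R = A := by
    ext i j
    exact congrFun (hr j) i
  calc gammaNorm p A ≤ √(pTrace (p / 2) (Bᵀ * Bᵀᵀ)) * norm12 R := by
        refine csInf_le ⟨0, ?_⟩ ⟨m, Bᵀ, R, hLR, rfl⟩
        rintro _ ⟨k, L, R, -, rfl⟩
        exact mul_nonneg (Real.sqrt_nonneg _) (norm_nonneg _)
    _ ≤ _ := mul_le_mul_of_nonneg_left (norm12_le R hC hrC) (Real.sqrt_nonneg _)

/-! ### Second moments of the noise -/

/-- The matrix `𝔼 z zᵀ` of second moments. -/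
noncomputable def secondMoment {m : ℕ} (ν : Measure (Fin m → ℝ)) : Matrix (Fin m) (Fin m) ℝ :=
  Matrix.of fun i j => ∫ z, z i * z j ∂ν

theorem integrable_coord_mul {m : ℕ} {ν : Measure (Fin m → ℝ)}
    (hL2 : ∀ i, MemLp (fun z : Fin m → ℝ => z i) 2 ν) (i j : Fin m) :
    Integrable (fun z => z i * z j) ν :=
  (hL2 i).integrable_mul (hL2 j)

theorem dotProduct_sq_eq_sum {m : ℕ} (θ z : Fin m → ℝ) :
    (θ ⬝ᵥ z) ^ 2 = ∑ i, ∑ j, θ i * θ j * (z i * z j) := by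
  rw [sq, dotProduct, Finset.sum_mul_sum]
  exact Finset.sum_congr rfl fun i _ => Finset.sum_congr rfl fun j _ => by ring

theorem integrable_dotProduct_sq {m : ℕ} {ν : Measure (Fin m → ℝ)}
    (hL2 : ∀ i, MemLp (fun z : Fin m → ℝ => z i) 2 ν) (θ : Fin m → ℝ) :
    Integrable (fun z => (θ ⬝ᵥ z) ^ 2) ν := by
  simp_rw [dotProduct_sq_eq_sum]
  exact integrable_finsetSum _ fun i _ => integrable_finsetSum _ fun j _ =>
    (integrable_coord_mul hL2 i j).const_mul _

theorem dotProduct_secondMoment_mulVec {m : ℕ} {ν : Measure (Fin m → ℝ)}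
    (hL2 : ∀ i, MemLp (fun z : Fin m → ℝ => z i) 2 ν) (θ : Fin m → ℝ) :
    θ ⬝ᵥ secondMoment ν *ᵥ θ = ∫ z, (θ ⬝ᵥ z) ^ 2 ∂ν := by
  simp_rw [dotProduct_sq_eq_sum]
  rw [integral_finsetSum _ fun i _ => integrable_finsetSum _ fun j _ =>
    (integrable_coord_mul hL2 i j).const_mul _]
  refine Finset.sum_congr rfl fun i _ => ?_
  rw [integral_finsetSum _ fun j _ => (integrable_coord_mul hL2 i j).const_mul _,
    Matrix.mulVec, dotProduct, Finset.mul_sum]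
  refine Finset.sum_congr rfl fun j _ => ?_
  rw [integral_const_mul, secondMoment, Matrix.of_apply]
  ring

theorem posSemidef_secondMoment {m : ℕ} {ν : Measure (Fin m → ℝ)}
    (hL2 : ∀ i, MemLp (fun z : Fin m → ℝ => z i) 2 ν) : (secondMoment ν).PosSemidef := by
  refine .of_dotProduct_mulVec_nonneg ?_ fun θ => ?_
  · ext i j
    simp [secondMoment, mul_comm]
  · rw [star_trivial, dotProduct_secondMoment_mulVec hL2]
    exact integral_nonneg fun z => sq_nonneg _

/-- Jensen in each coordinate: `t ↦ t^{p/2}` is convex because `p ≥ 2`, and the diagonal entries are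
`𝔼 zᵢ²`. -/
theorem sqrt_pTrace_secondMoment_le {m : ℕ} {ν : Measure (Fin m → ℝ)} [IsProbabilityMeasure ν]
    {p : ℝ} (hp : 2 ≤ p) (hL2 : ∀ i, MemLp (fun z : Fin m → ℝ => z i) 2 ν)
    (hLp : ∀ i, Integrable (fun z : Fin m → ℝ => |z i| ^ p) ν) :
    √(pTrace (p / 2) (secondMoment ν)) ≤ (∫ z, ∑ i, |z i| ^ p ∂ν) ^ (1 / p) := by
  have hdiag (i : Fin m) : 0 ≤ secondMoment ν i i :=
    integral_nonneg fun z => mul_self_nonneg (z i)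
  have hpow (x : ℝ) : |x| ^ p = (x * x) ^ (p / 2) := by
    rw [← abs_mul_abs_self x, ← sq, ← Real.rpow_natCast, ← Real.rpow_mul (abs_nonneg x)]
    congr 1
    push_cast
    ring
  have hjensen (i : Fin m) : secondMoment ν i i ^ (p / 2) ≤ ∫ z, |z i| ^ p ∂ν := by
    simp_rw [hpow]
    refine (convexOn_rpow (p := p / 2) (by linarith)).map_integral_le ?_ isClosed_Ici
      (ae_of_all _ fun z => mul_self_nonneg (z i)) (integrable_coord_mul hL2 i i) ?_
    · exact (Real.continuous_rpow_const (by linarith)).continuousOn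
    · simpa only [Function.comp_def, ← hpow] using hLp i
  rw [pTrace, Real.sqrt_eq_rpow, ← Real.rpow_mul
    (Finset.sum_nonneg fun i _ => Real.rpow_nonneg (hdiag i) _),
    show 1 / (p / 2) * (1 / 2) = 1 / p by field_simp, integral_finsetSum _ fun i _ => hLp i]
  exact Real.rpow_le_rpow (Finset.sum_nonneg fun i _ => Real.rpow_nonneg (hdiag i) _)
    (Finset.sum_le_sum fun i _ => hjensen i) (by positivity)

/-! ### The error as a moment of the noise, and the conclusion -/

theorem norm_toLp_rpow {m : ℕ} {p : ℝ} (hp : 0 < p) (z : Fin m → ℝ) :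
    ‖WithLp.toLp (ENNReal.ofReal p) z‖ ^ p = ∑ i, |z i| ^ p := by
  have hp' : (ENNReal.ofReal p).toReal = p := ENNReal.toReal_ofReal hp.le
  rw [PiLp.norm_eq_sum (by rwa [hp']), hp', ← Real.rpow_mul
    (Finset.sum_nonneg fun i _ => Real.rpow_nonneg (norm_nonneg _) _), one_div_mul_cancel hp.ne',
    Real.rpow_one]
  rfl

theorem lpError_eq_of_additive {m n : ℕ} {p : ℝ} (hp : 0 < p) {A : Matrix (Fin m) (Fin n) ℝ}
    {M : Mechanism n m} {ν : Measure (Fin m → ℝ)} {x : Fin n → ℝ}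
    (hν : (M x : Measure (Fin m → ℝ)) = ν.map (fun z => A *ᵥ x + z)) :
    lpError p A M x = (∫⁻ z, ENNReal.ofReal (∑ i, |z i| ^ p) ∂ν) ^ (1 / p) := by
  simp_rw [lpError, norm_toLp_rpow hp]
  rw [hν, lintegral_map (by fun_prop) (by fun_prop)]
  simp

/-- The lower bound for private additive noise mechanisms. No upper bound on `δ` is needed: the
bound is trivial unless `2 δ < 1 - exp (-ε)`, and in that case shifting the noise `⌈1 / (2 ε)⌉`
times along a column of `A` bounds its raw second moments in every direction, so that the matrix
`𝔼 z zᵀ` yields a factorization of `A`. -/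
theorem factorization_lower_bound {m n : ℕ} {ε : ℝ} (hε : 0 < ε) {p : ℝ} (hp : 2 ≤ p)
    (A : Matrix (Fin m) (Fin n) ℝ) {δ : ℝ} (hδ0 : 0 ≤ δ) (M : Mechanism n m)
    (hadd : IsAdditiveNoise A M) (hDP : IsDP ε δ M) (x : Fin n → ℝ) :
    ENNReal.ofReal
        ((1 - 2 * δ / (1 - Real.exp (-ε))) * gammaNorm p A / (8 * (Real.exp (3 * ε) - 1)))
      ≤ lpError p A M x := by
  have hp0 : 0 < p := by linarith
  have hF : 0 < 8 * (Real.exp (3 * ε) - 1) := by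
    have := Real.add_one_lt_exp (x := 3 * ε) (by positivity)
    linarith
  rcases le_or_gt 1 (2 * δ / (1 - Real.exp (-ε))) with hd | hd
  · rw [ENNReal.ofReal_of_nonpos]
    · exact zero_le
    · exact div_nonpos_of_nonpos_of_nonneg
        (mul_nonpos_of_nonpos_of_nonneg (by linarith) (gammaNorm_nonneg p A)) hF.le
  obtain ⟨ν, hν⟩ := hadd
  rw [lpError_eq_of_additive hp0 (hν x)]
  set ρ : Measure (Fin m → ℝ) := (ν : Measure (Fin m → ℝ))
  -- Once infinite error is excluded, every `zᵢ` lies in `L^p ⊆ L²`, so the entries of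
  -- `secondMoment` are true integrals rather than the default 0.
  by_cases htop : ∫⁻ z, ENNReal.ofReal (∑ i, |z i| ^ p) ∂ρ = ∞
  · rw [htop, ENNReal.top_rpow_of_pos (by positivity)]
    exact le_top
  have hnn (z : Fin m → ℝ) : 0 ≤ ∑ i, |z i| ^ p :=
    Finset.sum_nonneg fun i _ => Real.rpow_nonneg (abs_nonneg _) _
  have hmeas (i : Fin m) : Measurable fun z : Fin m → ℝ => |z i| ^ p := by fun_prop
  have hsum : Integrable (fun z : Fin m → ℝ => ∑ i, |z i| ^ p) ρ :=
    ⟨(Finset.measurable_fun_sum _ fun i _ => hmeas i).aestronglyMeasurable,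
      (hasFiniteIntegral_iff_ofReal (ae_of_all _ hnn)).mpr (lt_top_iff_ne_top.mpr htop)⟩
  have hLp (i : Fin m) : Integrable (fun z : Fin m → ℝ => |z i| ^ p) ρ := by
    refine hsum.mono' (hmeas i).aestronglyMeasurable (ae_of_all _ fun z => ?_)
    rw [Real.norm_of_nonneg (Real.rpow_nonneg (abs_nonneg _) _)]
    exact Finset.single_le_sum (f := fun i => |z i| ^ p)
      (fun i _ => Real.rpow_nonneg (abs_nonneg _) _) (Finset.mem_univ i)
  have hL2 (i : Fin m) : MemLp (fun z : Fin m → ℝ => z i) 2 ρ := by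
    have hpp : MemLp (fun z : Fin m → ℝ => z i) (ENNReal.ofReal p) ρ := by
      rw [← integrable_norm_rpow_iff (measurable_pi_apply i).aestronglyMeasurable (by simpa using hp0) ENNReal.ofReal_ne_top,
        ENNReal.toReal_ofReal hp0.le]
      exact hLp i
    exact hpp.mono_exponent (by
      rw [← ENNReal.ofReal_ofNat]; exact ENNReal.ofReal_le_ofReal hp)
  have hgamma := gammaNorm_le_of_posSemidef p A (posSemidef_secondMoment hL2)
    (C := 8 * (Real.exp (3 * ε) - 1) / (1 - 2 * δ / (1 - Real.exp (-ε))))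
    (div_nonneg hF.le (by linarith)) fun θ j => by
      rw [dotProduct_secondMoment_mulVec hL2, ← Matrix.mulVec_single_one]
      exact exists_shift_count hε hδ0 hd (integral_nonneg fun z => sq_nonneg _) fun k =>
        second_moment_of_shift hDP hν (by simp) θ (integrable_dotProduct_sq hL2 θ) k
  rw [← ofReal_integral_eq_lintegral_ofReal hsum (ae_of_all _ hnn),
    ENNReal.ofReal_rpow_of_nonneg (integral_nonneg hnn) (by positivity)]
  refine ENNReal.ofReal_le_ofReal (le_trans ?_ (sqrt_pTrace_secondMoment_le hp hL2 hLp))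
  have hd1 : 0 < 1 - 2 * δ / (1 - Real.exp (-ε)) := by linarith
  rw [← mul_div_assoc, le_div_iff₀ hd1] at hgamma
  rw [div_le_iff₀ hF]
  linarith

end DPLinearQueries

theorem mainTheorem4 {m n : ℕ} (ε : ℝ) (hε : 0 < ε) (p : ℝ) (hp : 2 ≤ p)
    (A : Matrix (Fin m) (Fin n) ℝ) (δ : ℝ) (hδ0 : 0 ≤ δ)
    (hδ : δ ≤ DPLinearQueries.deltaThreshold p ε A)
    (M : DPLinearQueries.Mechanism n m)
    (hadd : DPLinearQueries.IsAdditiveNoise A M)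
    (hDP : DPLinearQueries.IsDP ε δ M) (x : Fin n → ℝ) :
    ENNReal.ofReal
        ((1 - 2 * δ / (1 - Real.exp (-ε))) * DPLinearQueries.gammaNorm p A /
          (8 * (Real.exp (3 * ε) - 1)))
      ≤ DPLinearQueries.lpError p A M x :=
  DPLinearQueries.factorization_lower_bound hε hp A hδ0 M hadd hDP x
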